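/- We work with simplicial sets. A map of simplicial sets is a \emph{cofibration} if it has the left lifting property with respect to all maps having the right lifting property against every boundary inclusion $\partial\Delta[n]\hookrightarrow\Delta[n]$ (in classical logic: if it is a monomorphism), and $X$ is \emph{cofibrant} if $\emptyset\to X$ is a cofibration (in classical logic this always holds). A \emph{Kan fibration} is a map with the right lifting property against all horn inclusions $\Lambda^k[n]\hookrightarrow\Delta[n]$ ($n\ge 1$), and a map is \emph{anodyne} if it has the left lifting property against all Kan fibrations. Let $\mathcal K[n]$ be the poset of non-empty subsets of $[n]=\{0<\dots<n\}$, functorial in $[n]$ by direct images, and put $\mathrm{Sd}\,\Delta[n]=N\mathcal K[n]$ (nerve) and $(\mathrm{Ex}\,X)_n=\mathrm{Hom}(\mathrm{Sd}\,\Delta[n],X)$. The maps $\max:\mathcal K[n]\to[n]$ induce maps $\mathrm{Sd}\,\Delta[n]\to\Delta[n]$, and composition with these gives a natural map $n_X:X\to \mathrm{Ex}\,X$. Let $\mathrm{Ex}^\infty X$ be the colimit of $X\xrightarrow{n_X}\mathrm{Ex}\,X\xrightarrow{n_{\mathrm{Ex}X}}\mathrm{Ex}^2X\to\cdots$, with its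 natural map $X\to\mathrm{Ex}^\infty X$. A \emph{$P$-structure} on a cofibration $A\hookrightarrow B$ consists of a partition $B_{\mathrm I}\sqcup B_{\mathrm{II}}$ of the set of non-degenerate cells of $B$ not in $A$, and a bijection $P:B_{\mathrm{II}}\to B_{\mathrm I}$, such that for every $x\in B_{\mathrm{II}}$: (1) $\dim Px=\dim x+1$; (2) there is a unique $i$ with $d_i(Px)=x$; (3) $x$ has finite $P$-height. Here, for $x\in B_{\mathrm{II}}$ and $i$ as in (2), $\mathrm{Ant}(x)$ is the set consisting of the cells $d_jPx$ with $j\ne i$ and all their iterated faces; $\mathrm{Ant}(Px)=\mathrm{Ant}(x)$; $\mathrm{Ant}(b)=\emptyset$ for $b\in A$; $\mathrm{Ant}(b)=\mathrm{Ant}(b')$ if $b\notin A$ is a degeneracy of the non-degenerate cell $b'$; $\mathrm{Ant}^1=\mathrm{Ant}$, $\mathrm{Ant}^{k}(b)=\bigcup_{c\in \mathrm{Ant}(b)}\mathrm{Ant}^{k-1}(c)$; and $b$ has finite $P$-height if $\mathrm{Ant}^k(b)=\emptyset$ for some $k$. A map is \emph{strongly anodyne} if it is a cofibration admitting a $P$-structure.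 \textbf{Statement.} Let $X$ be a cofibrant simplicial set. For every map of simplicial sets $f:X\to Y$, the map $$X\longrightarrow \mathrm{Ex}^\infty X\times_{\mathrm{Ex}^\infty Y}Y$$ induced by $X\to\mathrm{Ex}^\infty X$ and $f$ is strongly anodyne. In particular, $X\to\mathrm{Ex}^\infty X$ is anodyne. -/

import Mathlib

open CategoryTheory Limits Opposite HomotopicalAlgebra
open scoped SSet.modelCategoryQuillen

universe u

namespace SSet

/-! ### The last vertex map and the natural transformation from the identity to `Ex` -/

/-- The maximum of a nonempty finite chain of a linearly ordered type. -/
noncomputable def chainMax {T : Type u} [LinearOrder T] :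
    PartialOrder.NonemptyFiniteChains T →o T where
  toFun s := s.finset.max' s.nonempty
  monotone' s _ h := Finset.max'_subset s.nonempty h

lemma chainMax_map {T U : Type u} [LinearOrder T] [LinearOrder U] (f : T →o U)
    (s : PartialOrder.NonemptyFiniteChains T) : chainMax (s.map f) = f (chainMax s) := by
  refine le_antisymm (Finset.max'_le _ (s.map f).nonempty _ fun y hy ↦ ?_) (Finset.le_max' (s.map f).finset _ ?_)
  · obtain ⟨z, hz, rfl⟩ := (s.mem_map_iff f y).1 hy
    exact f.monotone (Finset.le_max' s.finset z hz)
  · exact (s.mem_map_iff f _).2 ⟨_, Finset.max'_mem s.finset s.nonempty, rfl⟩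

/-- The natural order preserving map `max : 𝒦([n]) → [n]`. -/
noncomputable def maxTrans :
    SimplexCategory.toPartOrd.{u} ⋙ PartOrd.nonemptyFiniteChainsFunctor ⟶
      SimplexCategory.toPartOrd.{u} where
  app n := PartOrd.ofHom (chainMax (T := ULift.{u} (Fin (n.len + 1))))
  naturality n m f := by
    ext s
    exact chainMax_map (T := ULift.{u} (Fin (n.len + 1))) (U := ULift.{u} (Fin (m.len + 1)))
      (SimplexCategory.toPartOrd.map f).hom s

/-- The nerve of `[n]` is the standard simplex `Δ[n]`, naturally in `[n]`. -/
def nerveIsoStdSimplex :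
    SimplexCategory.toPartOrd.{u} ⋙ PartOrd.nerveFunctor ≅ SSet.stdSimplex.{u} :=
  NatIso.ofComponents (fun n ↦ (SSet.stdSimplex.isoNerve n.len).symm) (fun f ↦ by rfl)

/-- The map `Sd Δ[n] ⟶ Δ[n]` induced by `max : 𝒦([n]) → [n]`, naturally in `[n]`. -/
noncomputable def sdMax : SimplexCategory.sd.{u} ⟶ SSet.stdSimplex.{u} :=
  Functor.whiskerRight maxTrans PartOrd.nerveFunctor ≫ nerveIsoStdSimplex.hom

/-- The natural map `X ⟶ Ex X`: it sends an `n`-simplex `x : Δ[n] ⟶ X` of `X`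
to the `n`-simplex `Sd Δ[n] ⟶ Δ[n] ⟶ X` of `Ex X`. -/
noncomputable def toEx : 𝟭 SSet.{u} ⟶ ex where
  app X :=
    { app n := ↾fun x ↦ ULift.up (sdMax.app n.unop ≫ yonedaEquiv.symm x)
      naturality n m f := by
        ext x
        refine congrArg ULift.up ?_
        have h : yonedaEquiv.symm (X.map f x) =
            SSet.stdSimplex.map f.unop ≫ yonedaEquiv.symm x := by
          rw [Equiv.symm_apply_eq, ← yonedaEquiv_naturality, Equiv.apply_symm_apply]
          rfl
        exact (congrArg (sdMax.app m.unop ≫ ·) h).trans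
          (sdMax.naturality_assoc f.unop (yonedaEquiv.symm x)).symm }
  naturality X Y f := by
    ext n x
    refine congrArg ULift.up ?_
    exact (congrArg (sdMax.app n.unop ≫ ·) (yonedaEquiv_symm_comp x f)).symm.trans
      (Category.assoc _ _ _).symm

/-! ### The functor `Ex^∞` -/

/-- The `k`-fold iterate of the functor `Ex`. -/
noncomputable def exIter : ℕ → SSet.{u} ⥤ SSet.{u}
  | 0 => 𝟭 _
  | k + 1 => exIter k ⋙ ex

/-- The natural map `Ex^k X ⟶ Ex^(k+1) X`: the map `toEx` of the simplicial set `Ex^k X`. -/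
noncomputable def exIterSucc (k : ℕ) : exIter.{u} k ⟶ exIter (k + 1) :=
  Functor.whiskerLeft (exIter k) toEx

/-- The sequence `X ⟶ Ex X ⟶ Ex² X ⟶ ⋯`, functorially in `X`. -/
noncomputable def exSequence : SSet.{u} ⥤ ℕ ⥤ SSet.{u} :=
  (Functor.ofSequence exIterSucc).flip

/-- Kan's functor `Ex^∞`: the colimit of the sequence `X ⟶ Ex X ⟶ Ex² X ⟶ ⋯`. -/
noncomputable def exInfty : SSet.{u} ⥤ SSet.{u} :=
  exSequence ⋙ colim

/-- The natural map `X ⟶ Ex^∞ X`. -/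
noncomputable def toExInfty : 𝟭 SSet.{u} ⟶ exInfty where
  app X := colimit.ι (exSequence.obj X) 0
  naturality _ _ f := (ι_colimMap (exSequence.map f) 0).symm

/-- The map `X ⟶ Ex^∞ X ×_{Ex^∞ Y} Y` induced by `f : X ⟶ Y`. -/
noncomputable def toExInftyPullback {X Y : SSet.{u}} (f : X ⟶ Y) :
    X ⟶ pullback (Y := Y) (exInfty.map f) (toExInfty.app Y) :=
  pullback.lift (Y := Y) (toExInfty.app X) f (toExInfty.naturality f).symm

/-! ### `P`-structures and strongly anodyne maps -/

namespace Subcomplex.Pairing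

variable {B : SSet.{u}} {A : B.Subcomplex} (P : A.Pairing) [P.IsProper]

/-- `Ant₀(b)` for a cell `b` of type II: the cells `d_j (P b)` for `j ≠ i`, where `i` is the
unique index such that `d_i (P b) = b`. -/
def antZero (b : P.II) : Set B.S :=
  {c | ∃ j : Fin (b.1.dim + 2), j ≠ (P.isUniquelyCodimOneFace b).index rfl ∧
    c = S.mk (B.δ j ((P.p b).1.cast (P.isUniquelyCodimOneFace b).dim_eq).simplex)}

/-- `Ant(b)` for a cell `b` of type II: the elements of `Ant₀(b)` and all their iterated faces. -/
def antII (b : P.II) : Set B.S :=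
  {c | ∃ a ∈ P.antZero b, ∃ f : SimplexCategory.mk c.dim ⟶ SimplexCategory.mk a.dim,
    Mono f ∧ B.map f.op a.simplex = c.simplex}

/-- The set `Ant(b)` of antecedents of an arbitrary cell `b` of `B`. Let `b'` be the unique
nondegenerate cell of which `b` is a degeneracy (so `b' = b` if `b` is nondegenerate). If `b'` is
a cell `x` of type II, or the cell `P x` of type I, then `Ant(b) = Ant(x)`; otherwise `b` belongs
to `A` and `Ant(b)` is empty. -/
def ant (b : B.S) : Set B.S :=
  {c | ∃ x : P.II, (b.toN = x.1.toN ∨ b.toN = (P.p x).1.toN) ∧ c ∈ P.antII x}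

/-- The iterated antecedents: `Ant^0(b) = {b}` and `Ant^(k+1)(b) = ⋃_{c ∈ Ant(b)} Ant^k(c)`,
so that `Ant^1 = Ant`. -/
def antIter : ℕ → B.S → Set B.S
  | 0, b => {b}
  | k + 1, b => ⋃ c ∈ P.ant b, antIter k c

/-- A cell `b` has finite `P`-height if `Ant^k(b)` is empty for some `k`. -/
def HasFiniteHeight (b : B.S) : Prop := ∃ k : ℕ, P.antIter k b = ∅

end Subcomplex.Pairing

/-- A `P`-structure on a cofibration `f : A ⟶ B`: a partition of the nondegenerate cells of `B`
that are not in (the image of) `A` into cells of type I and cells of type II, with a bijection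
`P` from the latter to the former (these are the data of `pairing`), such that for every `x` of
type II one has `dim (P x) = dim x + 1` and `d_i (P x) = x` for a unique `i` (this is `isProper`),
and `x` has finite `P`-height. -/
structure PStructure {A B : SSet.{u}} (f : A ⟶ B) where
  pairing : (Subcomplex.range f).Pairing
  isProper : pairing.IsProper
  hasFiniteHeight : ∀ x : pairing.II, pairing.HasFiniteHeight x.1.toS

/-- A map of simplicial sets is strongly anodyne if it is a cofibration which admits
a `P`-structure. -/
def IsStronglyAnodyne {A B : SSet.{u}} (f : A ⟶ B) : Prop :=
  Cofibration f ∧ Nonempty (PStructure f)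

end SSet

namespace SSet

open Simplicial

/-! Filter the fibre product by the subcomplexes `F m` of simplices whose first component comes from
`Ex^m X`: `F 0` is the image of `X` and the `F m` exhaust everything. It suffices to pair off the
cells of `F (m + 1)` outside `F m` compatibly. A simplex of `Ex W` is a map `Sd Δ[n] ⟶ W`, so it can
be precomposed with any monotone map between posets of nonempty subsets, not only with direct
images. Two families are used, `fill n k` and `cone k`; for `c` the `cone k` of `x`, one has
`d_(k+1) c = x` and `d_k c` is `x` acted on by `fill n k`. The composite of all the fills is `s ↦
{0, ..., max s}`, which factors through `max`; hence a simplex fixed by every fill is one coming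
from `W` (`exAction_isFixed_iff`). If `x` is not fixed, let `k` be the greatest index whose fill
moves it, and put `P x = cone k x`. The cells of type I are the cones so obtained, those of type II
the other cells. A codimension one face of `P x` other than `x` that is a non-cone and is not fixed
has a smaller `k` (`IsTop.lt_of_δ_cone`), so the pair (stage, `k`) drops lexicographically. The
pairing is therefore regular, and its rank bounds the heights (`antIter_eq_empty`). For the second
component, each operator must cover, via `max`, a simplicial operator; it acts through the latter on
simplices coming from `Y` (`act_toEx`). Taking for `Y` a point, where `Ex^∞` changes nothing, shows
that `X ⟶ Ex^∞ X` is anodyne. -/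

/-- The partially ordered type of nonempty subsets of `{0, ..., n}`. -/
abbrev Chains (n : ℕ) : Type u := PartialOrder.NonemptyFiniteChains (ULift.{u} (Fin (n + 1)))

/-! ### Nonempty subsets of `{0, ..., n}`, described by membership of natural numbers -/

namespace Chains

variable {m n : ℕ}

/-- The natural number `i` belongs to the subset `s` of `{0, ..., n}`. -/
def Mem (i : ℕ) (s : Chains.{u} n) : Prop := ∃ h : i < n + 1, ULift.up ⟨i, h⟩ ∈ s.finset

lemma mem_finset_iff (s : Chains.{u} n) (a : ULift.{u} (Fin (n + 1))) :
    a ∈ s.finset ↔ Mem a.down s :=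
  ⟨fun h ↦ ⟨a.down.2, h⟩, fun ⟨_, h⟩ ↦ h⟩

lemma Mem.le {i : ℕ} {s : Chains.{u} n} (h : Mem i s) : i ≤ n := Nat.lt_succ_iff.1 h.1

lemma exists_mem (s : Chains.{u} n) : ∃ i, Mem i s := by
  obtain ⟨a, ha⟩ := s.nonempty
  exact ⟨_, (mem_finset_iff s a).1 ha⟩

lemma le_iff_mem {s t : Chains.{u} n} : s ≤ t ↔ ∀ i, Mem i s → Mem i t :=
  ⟨fun h _ ⟨h₁, h₂⟩ ↦ ⟨h₁, h h₂⟩, fun h a ha ↦ by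
    rw [mem_finset_iff] at ha ⊢
    exact h _ ha⟩

lemma ext_mem {s t : Chains.{u} n} (h : ∀ i, Mem i s ↔ Mem i t) : s = t :=
  le_antisymm (le_iff_mem.2 fun i ↦ (h i).1) (le_iff_mem.2 fun i ↦ (h i).2)

open scoped Classical in
/-- The nonempty subset of `{0, ..., n}` given by a predicate on natural numbers. -/
noncomputable def ofPred (n : ℕ) (p : ℕ → Prop) (hp : ∃ i ≤ n, p i) : Chains.{u} n where
  finset := Finset.univ.filter fun a ↦ p a.down
  nonempty := by
    obtain ⟨i, hi, h⟩ := hp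
    exact ⟨ULift.up ⟨i, by lia⟩, by simpa using h⟩
  comparable a b := le_total a b

lemma mem_ofPred {p : ℕ → Prop} (hp : ∃ i ≤ n, p i) (i : ℕ) :
    Mem i (ofPred.{u} n p hp) ↔ i ≤ n ∧ p i := by
  simp [Mem, ofPred]

/-- The maximum of a nonempty subset of `{0, ..., n}`. -/
noncomputable def top (s : Chains.{u} n) : ℕ := (chainMax s).down

lemma mem_top (s : Chains.{u} n) : Mem s.top s :=
  (mem_finset_iff s _).1 (Finset.max'_mem s.finset s.nonempty)

lemma le_top {i : ℕ} {s : Chains.{u} n} (h : Mem i s) : i ≤ s.top :=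
  Finset.le_max' s.finset _ h.2

lemma top_eq {s : Chains.{u} n} {i : ℕ} (h : Mem i s) (h' : ∀ j, Mem j s → j ≤ i) :
    s.top = i :=
  le_antisymm (h' _ (mem_top s)) (le_top h)

end Chains

open Chains

/-! ### Operators on subdivided simplices: faces, degeneracies, fills and cones -/

/-- Monotone maps between posets of nonempty subsets of `{0, ..., m}` and `{0, ..., n}`
for which the maximum of the image depends monotonically on the maximum. -/
structure SubdivHom (m n : ℕ) where
  /-- the underlying monotone map -/
  hom : Chains.{u} m →o Chains.{u} n
  exists_base : ∃ θ : ⦋m⦌ ⟶ ⦋n⦌, ∀ s,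
    (chainMax (hom s)).down = θ (chainMax s).down

namespace SubdivHom

variable {l m n : ℕ}

/-- The base map is only asserted to exist, so it plays no role in equality. Every identity between
operators thus becomes a propositional statement about membership of natural numbers. -/
lemma ext_mem {p q : SubdivHom.{u} m n} (h : ∀ s i, Mem i (p.hom s) ↔ Mem i (q.hom s)) :
    p = q := by
  obtain ⟨p, _⟩ := p
  obtain ⟨q, _⟩ := q
  obtain rfl : p = q := OrderHom.ext _ _ (funext fun s ↦ Chains.ext_mem (h s))
  rfl

/-- The identity. -/
def id (n : ℕ) : SubdivHom.{u} n n where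
  hom := OrderHom.id
  exists_base := ⟨𝟙 _, fun _ ↦ rfl⟩

/-- The composition. -/
def comp (q : SubdivHom.{u} m n) (p : SubdivHom.{u} l m) : SubdivHom.{u} l n where
  hom := q.hom.comp p.hom
  exists_base := by
    obtain ⟨θ, hθ⟩ := p.exists_base
    obtain ⟨ψ, hψ⟩ := q.exists_base
    exact ⟨θ ≫ ψ, fun s ↦ (hψ _).trans (congrArg ψ (hθ s))⟩

@[simp] lemma id_hom (s : Chains.{u} n) : (id n).hom s = s := rfl

@[simp] lemma comp_hom (q : SubdivHom.{u} m n) (p : SubdivHom.{u} l m) (s : Chains.{u} l) :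
    (q.comp p).hom s = q.hom (p.hom s) := rfl

/-- The map given by direct images. -/
noncomputable def ofHom (θ : ⦋m⦌ ⟶ ⦋n⦌) : SubdivHom.{u} m n where
  hom := (PartOrd.nonemptyFiniteChainsFunctor.map (SimplexCategory.toPartOrd.{u}.map θ)).hom
  exists_base := ⟨θ, fun s ↦ congrArg ULift.down (chainMax_map (T := ULift.{u} (Fin (m + 1)))
    (U := ULift.{u} (Fin (n + 1))) (SimplexCategory.toPartOrd.map θ).hom s)⟩

lemma mem_ofHom (θ : ⦋m⦌ ⟶ ⦋n⦌) (s : Chains.{u} m) (i : ℕ) :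
    Mem i ((ofHom θ).hom s) ↔ ∃ j : Fin (m + 1), Mem j s ∧ (θ j : ℕ) = i := by
  constructor
  · rintro ⟨_, h⟩
    obtain ⟨a, ha, h⟩ := (s.mem_map_iff (SimplexCategory.toPartOrd.{u}.map θ).hom _).1 h
    exact ⟨a.down, (mem_finset_iff s a).1 ha,
        congrArg (fun b : ULift (Fin (n + 1)) ↦ (b.down : ℕ)) h⟩
  · rintro ⟨j, ⟨_, hj⟩, rfl⟩
    exact ⟨(θ j).2, (s.mem_map_iff (SimplexCategory.toPartOrd.{u}.map θ).hom _).2 ⟨_, hj, rfl⟩⟩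

/-- The direct image by a coface map. -/
noncomputable def face (i : Fin (n + 2)) : SubdivHom.{u} n (n + 1) := ofHom (SimplexCategory.δ i)

/-- The direct image by a codegeneracy map. -/
noncomputable def degen (i : Fin (n + 1)) : SubdivHom.{u} (n + 1) n := ofHom (SimplexCategory.σ i)

lemma mem_face (i : Fin (n + 2)) (s : Chains.{u} n) (j : ℕ) :
    Mem j ((face i).hom s) ↔ (j < i ∧ Mem j s) ∨ ((i : ℕ) < j ∧ Mem (j - 1) s) := by
  have key (a : Fin (n + 1)) : (SimplexCategory.δ i a : ℕ) =
      if (a : ℕ) < i then (a : ℕ) else a + 1 := by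
    change ((i.succAbove a : Fin (n + 2)) : ℕ) = _
    simp only [Fin.succAbove, Fin.lt_def]
    split_ifs <;> simp_all
  rw [face, mem_ofHom]
  constructor
  · rintro ⟨a, ha, rfl⟩
    rw [key]
    split_ifs with h
    · exact Or.inl ⟨h, ha⟩
    · exact Or.inr ⟨by lia, by simpa using ha⟩
  · rintro (⟨h, hj⟩ | ⟨h, hj⟩)
    · exact ⟨⟨j, hj.1⟩, hj, by rw [key, if_pos h]⟩
    · refine ⟨⟨j - 1, hj.1⟩, hj, ?_⟩
      rw [key, if_neg (by dsimp; lia)]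
      dsimp; lia

lemma mem_degen (i : Fin (n + 1)) (s : Chains.{u} (n + 1)) (j : ℕ) :
    Mem j ((degen i).hom s) ↔ (j ≤ i ∧ Mem j s) ∨ ((i : ℕ) ≤ j ∧ Mem (j + 1) s) := by
  have key (a : Fin (n + 2)) : (SimplexCategory.σ i a : ℕ) =
      if (a : ℕ) ≤ i then (a : ℕ) else a - 1 := by
    change ((i.predAbove a : Fin (n + 1)) : ℕ) = _
    simp only [Fin.predAbove, Fin.lt_def, Fin.val_castSucc]
    split_ifs <;> (simp_all; try lia)
  rw [degen, mem_ofHom]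
  constructor
  · rintro ⟨a, ha, rfl⟩
    rw [key]
    split_ifs with h
    · exact Or.inl ⟨h, ha⟩
    · refine Or.inr ⟨by lia, ?_⟩
      rwa [Nat.sub_add_cancel (by lia)]
  · rintro (⟨h, hj⟩ | ⟨h, hj⟩)
    · exact ⟨⟨j, hj.1⟩, hj, by rw [key, if_pos h]⟩
    · refine ⟨⟨j + 1, hj.1⟩, hj, ?_⟩
      rw [key, if_neg (by dsimp; lia)]
      simp

/-- The closure operator on subsets of `{0, ..., n}` which adds `{0, ..., k}` to the subsets
containing `k`. -/
noncomputable def fill (n k : ℕ) : SubdivHom.{u} n n where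
  hom :=
    { toFun s := ofPred n (fun i ↦ Mem i s ∨ (i ≤ k ∧ Mem k s)) (by
        obtain ⟨i, hi⟩ := s.exists_mem
        exact ⟨i, hi.le, Or.inl hi⟩)
      monotone' s t h := by
        rw [le_iff_mem] at h ⊢
        intro i
        simp only [mem_ofPred]
        grind }
  exists_base := ⟨𝟙 _, fun s ↦ Fin.ext (top_eq
    ((mem_ofPred _ _).2 ⟨(mem_top s).le, Or.inl (mem_top s)⟩) fun j hj ↦ by
      obtain ⟨_, h | h⟩ := (mem_ofPred _ _).1 hj
      · exact le_top h
      · exact h.1.trans (le_top h.2))⟩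

lemma mem_fill (k : ℕ) (s : Chains.{u} n) (i : ℕ) :
    Mem i ((fill n k).hom s) ↔ Mem i s ∨ (i ≤ k ∧ Mem k s) := by
  refine (mem_ofPred _ _).trans (and_iff_right_of_imp ?_)
  rintro (h | ⟨h, h'⟩)
  · exact h.le
  · exact h.trans h'.le

lemma top_fill (k : ℕ) (s : Chains.{u} n) :
    (chainMax ((fill n k).hom s)).down = (𝟙 ⦋n⦌ : ⦋n⦌ ⟶ ⦋n⦌) (chainMax s).down :=
  Fin.ext (top_eq ((mem_fill _ _ _).2 (Or.inl (mem_top s))) fun j hj ↦ by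
    obtain h | h := (mem_fill _ _ _).1 hj
    · exact le_top h
    · exact h.1.trans (le_top h.2))

/-- The map which sends a subset `s` of `{0, ..., n + 1}` to its image by the `k`-th
codegeneracy map, together with `{0, ..., k}` if `k + 1` belongs to `s`. -/
noncomputable def cone (k : Fin (n + 1)) : SubdivHom.{u} (n + 1) n where
  hom :=
    { toFun s := ofPred n (fun i ↦ Mem i ((degen k).hom s) ∨ (i ≤ k ∧ Mem (k + 1) s)) (by
        obtain ⟨i, hi⟩ := ((degen k).hom s).exists_mem
        exact ⟨i, hi.le, Or.inl hi⟩)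
      monotone' s t h := by
        have h' := (degen k).hom.monotone h
        rw [le_iff_mem] at h h' ⊢
        intro i
        simp only [mem_ofPred]
        grind }
  exists_base := by
    obtain ⟨θ, hθ⟩ := (degen.{u} k).exists_base
    refine ⟨θ, fun s ↦ ?_⟩
    rw [← hθ]
    refine Fin.ext (top_eq ?_ fun j hj ↦ ?_)
    · exact (mem_ofPred _ _).2 ⟨(mem_top _).le, Or.inl (mem_top _)⟩
    · obtain ⟨_, h | h⟩ := (mem_ofPred _ _).1 hj
      · exact le_top h
      · exact h.1.trans (le_top ((mem_degen _ _ _).2 (Or.inr ⟨le_rfl, h.2⟩)))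

lemma mem_cone (k : Fin (n + 1)) (s : Chains.{u} (n + 1)) (i : ℕ) :
    Mem i ((cone k).hom s) ↔
      (i ≤ k ∧ Mem i s) ∨ ((k : ℕ) ≤ i ∧ Mem (i + 1) s) ∨ (i ≤ k ∧ Mem (k + 1) s) := by
  refine (mem_ofPred _ _).trans ((and_iff_right_of_imp ?_).trans ?_)
  · rintro (h | ⟨h, h'⟩)
    · exact h.le
    · lia
  · rw [mem_degen, or_assoc]

end SubdivHom

open SubdivHom

/-! ### Identities between the operators -/

namespace SubdivHom

variable {n : ℕ}

lemma cone_comp_face_succ (k : Fin (n + 1)) : (cone.{u} k).comp (face k.succ) = id n := by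
  apply ext_mem
  intro s i
  simp only [comp_hom, id_hom, mem_cone, mem_face, Fin.val_succ]
  grind

lemma cone_comp_face_castSucc (k : Fin (n + 1)) :
    (cone.{u} k).comp (face k.castSucc) = fill n k := by
  apply ext_mem
  intro s i
  simp only [comp_hom, mem_cone, mem_face, mem_fill, Fin.val_castSucc]
  grind

lemma cone_comp_face_of_gt (k : Fin (n + 1)) (j : Fin (n + 2)) (hkj : k.castSucc < j) :
    (cone.{u} k.castSucc).comp (face j.succ) = (face j).comp (cone k) := by
  apply ext_mem
  intro s i
  simp only [comp_hom, mem_cone, mem_face, Fin.val_castSucc, Fin.val_succ]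
  rw [Fin.lt_def] at hkj
  grind [Fin.val_castSucc]

/-- Coning twice at the same index gives a degenerate simplex; this is what keeps a cone from being
the partner of a nondegenerate cone. -/
lemma cone_comp_cone (k : Fin (n + 1)) :
    (cone.{u} k).comp (cone k.castSucc) = (cone k).comp (degen k.succ) := by
  apply ext_mem
  intro s i
  simp only [comp_hom, mem_cone, mem_degen, Fin.val_castSucc, Fin.val_succ]
  grind

lemma degen_comp_cone_of_lt (i k : Fin (n + 1)) (h : i ≤ k) :
    (degen.{u} i).comp (cone k.succ) = (cone k).comp (degen i.castSucc) := by
  apply ext_mem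
  intro s i
  simp only [comp_hom, mem_cone, mem_degen, Fin.val_castSucc, Fin.val_succ]
  grind

lemma degen_comp_cone_of_gt (i k : Fin (n + 1)) (h : k < i) :
    (degen.{u} i).comp (cone k.castSucc) = (cone k).comp (degen i.succ) := by
  apply ext_mem
  intro s i
  simp only [comp_hom, mem_cone, mem_degen, Fin.val_castSucc, Fin.val_succ]
  grind

lemma cone_comp_fill_of_gt (k : Fin (n + 1)) (l : ℕ) (h : k < l) :
    (cone.{u} k).comp (fill (n + 1) (l + 1)) = (fill n l).comp (cone k) := by
  apply ext_mem
  intro s i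
  simp only [comp_hom, mem_cone, mem_fill]
  grind

lemma cone_comp_fill_succ (k : Fin (n + 1)) :
    (cone.{u} k).comp (fill (n + 1) (k + 1)) = cone k := by
  apply ext_mem
  intro s i
  simp only [comp_hom, mem_cone, mem_fill]
  grind

lemma cone_comp_fill_self (k : Fin (n + 1)) :
    (cone.{u} k).comp (fill (n + 1) k) = (fill n k).comp (cone k) := by
  apply ext_mem
  intro s i
  simp only [comp_hom, mem_cone, mem_fill]
  grind

lemma degen_comp_fill_comp_face (k : Fin (n + 1)) :
    (degen.{u} k).comp ((fill (n + 1) (k + 1)).comp (face k.castSucc)) = fill n k := by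
  apply ext_mem
  intro s i
  simp only [comp_hom, mem_degen, mem_fill, mem_face, Fin.val_castSucc]
  grind

lemma fill_comp_degen_comp_fill (k : Fin (n + 1)) :
    (fill.{u} n k).comp ((degen k).comp (fill (n + 1) k)) = (fill n k).comp (degen k) := by
  apply ext_mem
  intro s i
  simp only [comp_hom, mem_degen, mem_fill]
  grind

/-- The coface shifts `l` to `l + 1` here, so whatever the inner fill adds is added again by the
outer one. In the next lemma `l` is not shifted. -/
lemma fill_comp_face_comp_fill_of_le (i : Fin (n + 2)) (l : ℕ) (h : i ≤ l) :
    (fill.{u} (n + 1) (l + 1)).comp ((face i).comp (fill n l)) =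
      (fill (n + 1) (l + 1)).comp (face i) := by
  apply ext_mem
  intro s j
  simp only [comp_hom, mem_face, mem_fill]
  grind

lemma fill_comp_face_comp_fill_of_gt (i : Fin (n + 2)) (l : ℕ) (h : l < i) :
    (fill.{u} (n + 1) l).comp ((face i).comp (fill n l)) =
      (fill (n + 1) l).comp (face i) := by
  apply ext_mem
  intro s j
  simp only [comp_hom, mem_face, mem_fill]
  grind

lemma fill_of_lt (l : ℕ) (h : n < l) : fill.{u} n l = id n := by
  apply ext_mem
  intro s j
  have := fun h : Mem l s ↦ h.le
  simp only [id_hom, mem_fill]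
  grind

end SubdivHom

/-! ### Simplicial sets with an action of the operators: tops and cones -/

/-- An extension of the presheaf structure of a simplicial set to the category with morphisms
`SubdivHom`. -/
structure SubdivAction (V : SSet.{u}) where
  /-- the action of morphisms -/
  act {m n : ℕ} (p : SubdivHom.{u} m n) (x : V _⦋n⦌) : V _⦋m⦌
  act_comp {l m n : ℕ} (q : SubdivHom.{u} m n) (p : SubdivHom.{u} l m) (x : V _⦋n⦌) :
    act (q.comp p) x = act p (act q x)
  act_ofHom {m n : ℕ} (θ : ⦋m⦌ ⟶ ⦋n⦌) (x : V _⦋n⦌) : act (ofHom θ) x = V.map θ.op x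

namespace SubdivAction

variable {V : SSet.{u}} (a : SubdivAction V) {n : ℕ}

lemma act_id (x : V _⦋n⦌) : a.act (SubdivHom.id n) x = x := by
  have : SubdivHom.id.{u} n = ofHom (𝟙 _) := by
    apply SubdivHom.ext_mem
    intro s i
    rw [mem_ofHom]
    exact ⟨fun h ↦ ⟨⟨i, h.1⟩, h, rfl⟩, by rintro ⟨j, h, rfl⟩; exact h⟩
  rw [this, act_ofHom, op_id, V.map_id]
  rfl

lemma act_face (i : Fin (n + 2)) (x : V _⦋n + 1⦌) : a.act (face i) x = V.δ i x :=
  a.act_ofHom _ _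

lemma act_degen (i : Fin (n + 1)) (x : V _⦋n⦌) : a.act (degen i) x = V.σ i x :=
  a.act_ofHom _ _

/-- A simplex is fixed if it is invariant under the operators `fill n k`. -/
def IsFixed (x : V _⦋n⦌) : Prop := ∀ k, a.act (fill n k) x = x

/-- The integer `k` is the greatest one such that `x` is not invariant under `fill n k`. -/
def IsTop (x : V _⦋n⦌) (k : Fin (n + 1)) : Prop :=
  a.act (fill n k) x ≠ x ∧ ∀ l : ℕ, k < l → a.act (fill n l) x = x

/-- The simplices obtained from the operators `cone k`. -/
inductive IsCone : ∀ {n : ℕ}, V _⦋n⦌ → Prop where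
  | mk {n : ℕ} (x : V _⦋n⦌) (k : Fin (n + 1)) (h : a.IsTop x k) : IsCone (a.act (cone k) x)

variable {a}

lemma exists_isTop {x : V _⦋n⦌} (hx : ¬ a.IsFixed x) : ∃ k, a.IsTop x k := by
  classical
  have h : ∃ l, ∀ j, l ≤ j → a.act (fill n j) x = x :=
    ⟨n + 1, fun j hj ↦ by rw [fill_of_lt j (by lia), a.act_id]⟩
  obtain ⟨l, hl⟩ : ∃ l, Nat.find h = l + 1 := Nat.exists_eq_succ_of_ne_zero fun h₀ ↦
    hx fun k ↦ Nat.find_spec h k (by lia)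
  have h₁ : a.act (fill n l) x ≠ x := fun h₁ ↦
    Nat.find_min h (m := l) (by lia) fun j hj ↦ by
      obtain rfl | hj := hj.eq_or_lt
      · exact h₁
      · exact Nat.find_spec h j (by lia)
  have h₂ : l < n + 1 := by
    by_contra h₂
    exact h₁ (by rw [fill_of_lt l (by lia), a.act_id])
  exact ⟨⟨l, h₂⟩, h₁, fun j hj ↦ Nat.find_spec h j (by rw [hl]; exact hj)⟩

namespace IsTop

variable {x : V _⦋n⦌} {k : Fin (n + 1)}

lemma not_isFixed (h : a.IsTop x k) : ¬ a.IsFixed x := fun h' ↦ h.1 (h' _)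

lemma le_of_forall (h : a.IsTop x k) {l : ℕ} (hl : ∀ j, l < j → a.act (fill n j) x = x) :
    k ≤ l := by
  by_contra! hlk
  exact h.1 (hl _ hlk)

lemma eq (h : a.IsTop x k) {l : Fin (n + 1)} (h' : a.IsTop x l) : k = l :=
  le_antisymm (h.le_of_forall h'.2) (h'.le_of_forall h.2)

end IsTop

variable {x : V _⦋n⦌} {k : Fin (n + 1)}

lemma δ_succ_cone (x : V _⦋n⦌) (k : Fin (n + 1)) : V.δ k.succ (a.act (cone k) x) = x := by
  rw [← a.act_face, ← act_comp, cone_comp_face_succ, act_id]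

lemma δ_castSucc_cone (x : V _⦋n⦌) (k : Fin (n + 1)) :
    V.δ k.castSucc (a.act (cone k) x) = a.act (fill n k) x := by
  rw [← a.act_face, ← act_comp, cone_comp_face_castSucc]

lemma cone_injective (k : Fin (n + 1)) : Function.Injective (a.act (V := V) (cone k)) :=
  fun x y h ↦ by rw [← δ_succ_cone (a := a) x k, h, δ_succ_cone]

lemma δ_cone_of_gt (x : V _⦋n + 1⦌) (k : Fin (n + 1)) (j : Fin (n + 2)) (h : k.castSucc < j) :
    V.δ j.succ (a.act (cone k.castSucc) x) = a.act (cone k) (V.δ j x) := by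
  rw [← a.act_face, ← act_comp, cone_comp_face_of_gt k j h, act_comp, a.act_face]

/-- Fills commute past the cone with a shift of index above `k`, and coning is injective, so
invariance transfers both ways. The extra index `k + 1` is harmless, since the cone has already
performed that fill. -/
lemma isTop_cone_iff : a.IsTop (a.act (cone k) x) k.castSucc ↔ a.IsTop x k := by
  have h₁ : a.act (fill (n + 1) k) (a.act (cone k) x) = a.act (cone k) x ↔
      a.act (fill n k) x = x := by
    rw [← act_comp, cone_comp_fill_self, act_comp, (cone_injective k).eq_iff]
  have h₂ (l : ℕ) (hl : k < l) :
      a.act (fill (n + 1) (l + 1)) (a.act (cone k) x) = a.act (cone k) x ↔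
          a.act (fill n l) x = x := by
    rw [← act_comp, cone_comp_fill_of_gt k l hl, act_comp, (cone_injective k).eq_iff]
  refine and_congr (not_congr h₁) ⟨fun h l hl ↦ (h₂ l hl).1 (h _ (Nat.lt_succ_of_lt hl)),
      fun h l hl ↦ ?_⟩
  obtain ⟨l, rfl⟩ := Nat.exists_eq_succ_of_ne_zero (show l ≠ 0 by rintro rfl; simp at hl)
  obtain hl' | hl' := (Nat.le_of_lt_succ hl).eq_or_lt
  · rw [← act_comp]
    have := cone_comp_fill_succ.{u} k
    simp only [Fin.val_castSucc] at hl'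
    rw [hl'] at this
    rw [Nat.succ_eq_add_one, this]
  · exact (h₂ l hl').2 (h l hl')

lemma fill_δ_of_le {x : V _⦋n + 1⦌} {i : Fin (n + 2)} {l : ℕ} (hi : i ≤ l)
    (h : a.act (fill (n + 1) (l + 1)) x = x) : a.act (fill n l) (V.δ i x) = V.δ i x := by
  have := congrArg (fun p ↦ a.act p x) (fill_comp_face_comp_fill_of_le i l hi)
  simpa only [act_comp, h, act_face] using this

lemma fill_δ_of_gt {x : V _⦋n + 1⦌} {i : Fin (n + 2)} {l : ℕ} (hi : l < i)
    (h : a.act (fill (n + 1) l) x = x) : a.act (fill n l) (V.δ i x) = V.δ i x := by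
  have := congrArg (fun p ↦ a.act p x) (fill_comp_face_comp_fill_of_gt i l hi)
  simpa only [act_comp, h, act_face] using this

/-- The faces of `a.act (cone k) x` other than `x` which are not themselves cones have
a smaller top. -/
lemma IsTop.lt_of_δ_cone (hx : a.IsTop x k) {j : Fin (n + 2)} (hj : j ≠ k.succ)
    {k' : Fin (n + 1)} (h : a.IsTop (V.δ j (a.act (cone k) x)) k')
    (h' : ¬ a.IsCone (V.δ j (a.act (cone k) x))) : k' < k := by
  have hx' := isTop_cone_iff.2 hx
  by_contra! hk
  -- For `j ≤ k`, invariance of the cone under the fill at `k' + 1 > k` descends to invariance of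
  -- the face under the fill at `k'`, contradicting the choice of `k'`.
  by_cases hjk : (j : ℕ) ≤ k
  · exact h.1 (fill_δ_of_le (hjk.trans hk) (hx'.2 _ (Nat.lt_succ_of_le hk)))
  · have hjk' : (k : ℕ) + 1 < j := by
      have : (j : ℕ) ≠ k + 1 := fun h ↦ hj (Fin.ext h)
      lia
    obtain _ | n := n
    · lia
    obtain ⟨k, rfl⟩ := Fin.eq_castSucc_of_ne_last (x := k) (by rintro rfl; simp at hjk'; lia)
    obtain ⟨j, rfl⟩ := Fin.eq_succ_of_ne_zero (i := j) (by rintro rfl; simp at hjk')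
    have hkj : k.castSucc < j := by
      simp only [Fin.val_castSucc, Fin.val_succ] at hjk'
      exact Fin.lt_def.2 (by simpa using hjk')
    -- For `j > k + 1` the face is the cone of a face of `x`. Its top is at most `k`, hence equal to
    -- `k`, which makes it a cone in the sense of `IsCone`.
    obtain rfl : k' = k.castSucc := by
      refine le_antisymm (h.le_of_forall fun l hl ↦ ?_) hk
      by_cases hlj : l ≤ j
      · exact fill_δ_of_gt (Nat.lt_succ_of_le hlj) (hx'.2 l hl)
      · exact fill_δ_of_le (by simp only [Fin.val_succ]; lia) (hx'.2 (l + 1) (Nat.lt_succ_of_lt hl))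
    rw [δ_cone_of_gt _ _ _ hkj] at h h'
    exact h' (.mk _ _ (isTop_cone_iff.1 h))

lemma IsTop.eq_succ_of_δ_cone_eq (hx : a.IsTop x k) (h : ¬ a.IsCone x) {j : Fin (n + 2)}
    (hj : V.δ j (a.act (cone k) x) = x) : j = k.succ := by
  by_contra hj'
  exact lt_irrefl k (hx.lt_of_δ_cone hj' (by rwa [hj]) (by rwa [hj]))

/-- Suppose that the cone is `σ_i y` and compare with `d_(k+1)`. If `i < k` or `i > k + 1`, then `x`
is degenerate; if `i = k`, the faces `d_k` and `d_(k+1)` agree, so `x` is fixed by its top fill; if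
`i = k + 1`, then `x` is the cone of its face `d_(k+1) x`. -/
lemma IsTop.cone_mem_nonDegenerate (hx : a.IsTop x k) (h : ¬ a.IsCone x)
    (hx' : x ∈ V.nonDegenerate n) : a.act (cone k) x ∈ V.nonDegenerate (n + 1) := by
  intro hd
  rw [degenerate_eq_iUnion_range_σ] at hd
  obtain ⟨i, y, hy⟩ := Set.mem_iUnion.1 hd
  have hxy : V.δ k.succ (V.σ i y) = x := by rw [hy, δ_succ_cone]
  obtain hik | rfl | hik := lt_trichotomy i k
  · obtain _ | n := n
    · lia
    obtain ⟨i, rfl⟩ := Fin.eq_castSucc_of_ne_last (x := i)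
        (by rintro rfl; exact absurd k.le_last hik.not_ge)
    rw [δ_comp_σ_of_gt_apply hik] at hxy
    exact hx' (hxy ▸ V.σ_mem_degenerate _ _)
  · rw [δ_comp_σ_succ_apply] at hxy
    subst hxy
    apply hx.1
    rw [← δ_castSucc_cone, ← hy, δ_comp_σ_self_apply]
  · obtain _ | n := n
    · lia
    obtain ⟨k, rfl⟩ := Fin.eq_castSucc_of_ne_last (x := k)
        (by rintro rfl; exact absurd i.le_last hik.not_ge)
    obtain ⟨i, rfl⟩ := Fin.eq_succ_of_ne_zero (i := i)
        (by rintro rfl; exact absurd (Fin.zero_le _) hik.not_ge)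
    obtain hik' | rfl := (Fin.le_iff_val_le_val.2 (Nat.le_of_lt_succ hik) : k ≤ i).lt_or_eq
    · rw [Fin.succ_castSucc, δ_comp_σ_of_le_apply (Fin.succ_le_castSucc_iff.2 hik')] at hxy
      exact hx' (hxy ▸ V.σ_mem_degenerate _ _)
    · have hxy' : x = y := by
        rw [← hxy, Fin.succ_castSucc, δ_comp_σ_self_apply]
      subst hxy'
      have h' : a.act (cone k) (V.δ k.succ x) = x := by
        rw [← δ_cone_of_gt _ _ _ (Fin.castSucc_lt_succ), ← hy, δ_comp_σ_succ_apply]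
      have hx₂ := hx
      rw [← h'] at h hx₂
      exact h (.mk _ _ (isTop_cone_iff.1 hx₂))

lemma IsTop.mem_nonDegenerate_of_cone (hx : a.IsTop x k)
    (h : a.act (cone k) x ∈ V.nonDegenerate (n + 1)) : x ∈ V.nonDegenerate n := by
  intro hd
  obtain _ | n := n
  · simp at hd
  rw [degenerate_eq_iUnion_range_σ] at hd
  obtain ⟨i, y, rfl⟩ := Set.mem_iUnion.1 hd
  apply h
  rw [← a.act_degen] at hx ⊢
  obtain hik | hik | hik := lt_trichotomy k i.castSucc
  · obtain ⟨k, rfl⟩ := Fin.eq_castSucc_of_ne_last (x := k)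
      (by rintro rfl; exact absurd i.castSucc.le_last hik.not_ge)
    rw [← act_comp, degen_comp_cone_of_gt i k (Fin.castSucc_lt_castSucc_iff.1 hik),
        act_comp, a.act_degen]
    exact V.σ_mem_degenerate _ _
  -- Coning does not commute with `σ_k` in this case. Instead, invariance of `σ_k y` under the fill
  -- at `k + 1` makes `y` invariant at `k`, hence `σ_k y` too, against the choice of the top.
  · subst hik
    exfalso
    have h₁ : a.act (fill n i) y = y := by
      rw [← degen_comp_fill_comp_face, act_comp, act_comp]
      have := hx.2 (i + 1) (Nat.lt_succ_self _)
      rw [this, a.act_degen, a.act_face, δ_comp_σ_self_apply]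
    have h₂ := congrArg (fun p ↦ a.act p y) (fill_comp_degen_comp_fill i)
    simp only [act_comp, h₁] at h₂
    exact hx.1 h₂
  · obtain ⟨k, rfl⟩ := Fin.eq_succ_of_ne_zero (i := k)
      (by rintro rfl; exact absurd (Fin.zero_le _) hik.not_ge)
    rw [← act_comp, degen_comp_cone_of_lt _ _ (Fin.le_iff_val_le_val.2 (Nat.le_of_lt_succ hik)),
        act_comp, a.act_degen]
    exact V.σ_mem_degenerate _ _

lemma IsTop.not_isCone_of_cone (hx : a.IsTop x k)
    (h : a.act (cone k) x ∈ V.nonDegenerate (n + 1)) : ¬ a.IsCone x := by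
  rintro ⟨y, l, hy⟩
  obtain rfl := hx.eq (isTop_cone_iff.2 hy)
  rw [← act_comp, cone_comp_cone, act_comp, a.act_degen] at h
  exact h (V.σ_mem_degenerate _ _)

end SubdivAction

/-! ### The pairing attached to a tower, and its regularity -/

/-- An exhaustive filtration of a simplicial set by subcomplexes, starting with `A`, such that each
step is the inclusion of the fixed simplices for an action of the maps between posets of
nonempty subsets. -/
structure SubdivTower {B : SSet.{u}} (A : B.Subcomplex) where
  /-- the filtration -/
  filtration : ℕ → B.Subcomplex
  filtration_zero : filtration 0 = A
  monotone : Monotone filtration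
  exists_mem {n : ℕ} (x : B _⦋n⦌) : ∃ m, x ∈ (filtration m).obj (op ⦋n⦌)
  /-- the action -/
  action (m : ℕ) : SubdivAction (filtration (m + 1) : SSet.{u})
  isFixed_iff {m n : ℕ} (x : (filtration (m + 1) : SSet.{u}) _⦋n⦌) :
    (action m).IsFixed x ↔ x.1 ∈ (filtration m).obj (op ⦋n⦌)

namespace SubdivTower

variable {B : SSet.{u}} {A : B.Subcomplex} (T : SubdivTower A)

/-- The nondegenerate simplices which do not belong to `A` and are not cones. -/
structure Index where
  /-- the dimension -/
  dim : ℕ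
  /-- the step of the filtration -/
  level : ℕ
  /-- the simplex -/
  simplex : (T.filtration (level + 1) : SSet.{u}) _⦋dim⦌
  /-- the greatest integer such that the simplex is not fixed by the corresponding operator -/
  top : Fin (dim + 1)
  isTop : (T.action level).IsTop simplex top
  not_isCone : ¬ (T.action level).IsCone simplex
  mem_nonDegenerate : simplex ∈ nonDegenerate (T.filtration (level + 1) : SSet.{u}) dim

variable {T}

/-- A non-fixed simplex of stage `m + 1` is not in stage `m`, so it lies in no earlier stage. Used
in both directions, this shows that a cell determines its level. -/
lemma level_unique {m m' n : ℕ} {x : (T.filtration (m + 1) : SSet.{u}) _⦋n⦌}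
    {x' : (T.filtration (m' + 1) : SSet.{u}) _⦋n⦌} (h : x.1 = x'.1)
    (hx : ¬ (T.action m).IsFixed x) : m ≤ m' := by
  by_contra! hm
  refine hx ((T.isFixed_iff x).2 ?_)
  rw [h]
  exact T.monotone hm _ x'.2

lemma notMem_of_not_isFixed {m n : ℕ} {x : (T.filtration (m + 1) : SSet.{u}) _⦋n⦌}
    (hx : ¬ (T.action m).IsFixed x) : x.1 ∉ A.obj (op ⦋n⦌) := fun h ↦ by
  have h₀ := T.filtration_zero.ge _ h
  exact hx ((T.isFixed_iff x).2 (T.monotone (Nat.zero_le m) _ h₀))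

namespace Index

variable (s : T.Index)

/-- The cone of the simplex attached to an index. -/
noncomputable def cone : (T.filtration (s.level + 1) : SSet.{u}) _⦋s.dim + 1⦌ :=
  (T.action s.level).act (SubdivHom.cone s.top) s.simplex

lemma isTop_cone : (T.action s.level).IsTop s.cone s.top.castSucc :=
  SubdivAction.isTop_cone_iff.2 s.isTop

lemma δ_cone : B.δ s.top.succ s.cone.1 = s.simplex.1 :=
  congrArg Subtype.val (SubdivAction.δ_succ_cone (a := T.action s.level) s.simplex s.top)

lemma ext_simplex {s t : T.Index} (h : S.mk s.simplex.1 = S.mk t.simplex.1) : s = t := by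
  obtain ⟨n, m, x, k, hx, h₁, h₂⟩ := s
  obtain ⟨n', m', x', k', hx', h₁', h₂'⟩ := t
  obtain rfl : n = n' := congrArg S.dim h
  have h : x.1 = x'.1 := by simpa using h
  obtain rfl : m = m' := le_antisymm (level_unique h hx.not_isFixed)
    (level_unique h.symm hx'.not_isFixed)
  obtain rfl : x = x' := Subtype.ext h
  obtain rfl := hx.eq hx'
  rfl

lemma ext_cone {s t : T.Index} (h : S.mk s.cone.1 = S.mk t.cone.1) : s = t := by
  have hd : s.dim = t.dim := Nat.succ_injective (congrArg S.dim h)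
  have hs := s.isTop_cone
  have ht := t.isTop_cone
  have hs' := s.δ_cone
  have ht' := t.δ_cone
  refine ext_simplex ?_
  -- Writing both simplices as faces of their cones leaves only the cones and the tops to be
  -- compared, and a cone determines its top.
  rw [← hs', ← ht']
  generalize s.cone = x at *
  generalize t.cone = y at *
  generalize s.top = k at *
  generalize t.top = l at *
  clear hs' ht'
  generalize s.dim = n at *
  generalize t.dim = n' at *
  subst hd
  have h : x.1 = y.1 := by simpa using h
  have hm : s.level = t.level := le_antisymm (level_unique h hs.not_isFixed)
    (level_unique h.symm ht.not_isFixed)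
  generalize s.level = m at *
  generalize t.level = m' at *
  subst hm
  obtain rfl : x = y := Subtype.ext h
  obtain rfl : k = l := Fin.castSucc_injective _ (hs.eq ht)
  rfl

lemma cone_ne (s t : T.Index) : S.mk s.cone.1 ≠ S.mk t.simplex.1 := by
  obtain ⟨n, m, x, k, hx, h₁, h₂⟩ := t
  intro h
  obtain rfl : s.dim + 1 = n := congrArg S.dim h
  replace h : s.cone.1 = x.1 := by simpa using h
  obtain rfl : s.level = m := le_antisymm (level_unique h s.isTop_cone.not_isFixed)
    (level_unique h.symm hx.not_isFixed)
  obtain rfl := Subtype.ext h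
  exact h₁ (.mk _ _ s.isTop)

lemma surjective {n : ℕ} (x : B _⦋n⦌) (hx : x ∈ B.nonDegenerate n) (hA : x ∉ A.obj (op ⦋n⦌)) :
    ∃ s : T.Index, S.mk x = S.mk s.cone.1 ∨ S.mk x = S.mk s.simplex.1 := by
  classical
  have h := T.exists_mem x
  -- The level is one less than the first stage containing `x`; that stage is not `0`, because stage
  -- `0` is `A`.
  obtain ⟨m, hm⟩ : ∃ m, Nat.find h = m + 1 := Nat.exists_eq_succ_of_ne_zero fun h₀ ↦ hA (by
    have := Nat.find_spec h
    rwa [h₀, T.filtration_zero] at this)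
  obtain ⟨y, rfl⟩ : ∃ y : (T.filtration (m + 1) : SSet.{u}) _⦋n⦌, y.1 = x :=
    ⟨⟨x, hm ▸ Nat.find_spec h⟩, rfl⟩
  have hy : y ∈ nonDegenerate (T.filtration (m + 1) : SSet.{u}) n :=
    (Subcomplex.mem_nonDegenerate_iff _ _).2 hx
  obtain ⟨k, hk⟩ := SubdivAction.exists_isTop (a := T.action m) (x := y) fun h' ↦
    Nat.find_min h (m := m) (by lia) ((T.isFixed_iff y).1 h')
  by_cases hc : (T.action m).IsCone y
  · obtain ⟨z, l, hz⟩ := hc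
    exact ⟨⟨_, m, z, l, hz, hz.not_isCone_of_cone hy, hz.mem_nonDegenerate_of_cone hy⟩, Or.inl rfl⟩
  · exact ⟨⟨n, m, y, k, hk, hc, hy⟩, Or.inr rfl⟩

end Index

variable (T)

/-- The pairing attached to a tower: the simplices of type I are the cones. -/
noncomputable def pairingCore : A.PairingCore where
  ι := T.Index
  dim s := s.dim
  simplex s := s.cone.1
  index s := s.top.succ
  nonDegenerate₁ s := (Subcomplex.mem_nonDegenerate_iff _ _).1
    (s.isTop.cone_mem_nonDegenerate s.not_isCone s.mem_nonDegenerate)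
  nonDegenerate₂ s := by
    rw [s.δ_cone]
    exact (Subcomplex.mem_nonDegenerate_iff _ _).1 s.mem_nonDegenerate
  notMem₁ s := notMem_of_not_isFixed s.isTop_cone.not_isFixed
  notMem₂ s := by
    rw [s.δ_cone]
    exact notMem_of_not_isFixed s.isTop.not_isFixed
  injective_type₁' h := Index.ext_cone h
  injective_type₂' {s t} h := by
    rw [s.δ_cone, t.δ_cone] at h
    exact Index.ext_simplex h
  type₁_ne_type₂' s t := by
    rw [t.δ_cone]
    exact s.cone_ne t
  surjective' x := by
    obtain ⟨s, hs⟩ := Index.surjective (T := T) x.simplex x.nonDegenerate x.notMem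
    refine ⟨s, ?_⟩
    rw [s.δ_cone]
    exact hs

instance : T.pairingCore.IsProper where
  isUniquelyCodimOneFace (s : T.Index) := by
    refine (S.IsUniquelyCodimOneFace.iff (B.δ s.top.succ s.cone.1) s.cone.1).2
      ⟨s.top.succ, rfl, fun j hj ↦ ?_⟩
    rw [s.δ_cone] at hj
    exact s.isTop.eq_succ_of_δ_cone_eq s.not_isCone (Subtype.ext hj)

/-- The weak rank function given by the step of the filtration and the greatest integer
such that the simplex is not fixed by the corresponding operator. -/
noncomputable def weakRankFunction : T.pairingCore.WeakRankFunction (ℕ ×ₗ ℕ) where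
  rank (s : T.Index) := toLex (s.level, (s.top : ℕ))
  lt {s t} hst hd := by
    change T.Index at s t
    obtain ⟨hne, hlt⟩ := hst
    obtain ⟨f, hmono, hf⟩ := N.le_iff_exists_mono.1 hlt.le
    change ⦋s.dim⦌ ⟶ ⦋t.dim + 1⦌ at f
    replace hmono : Mono f := hmono
    replace hf : B.map f.op t.cone.1 = s.simplex.1 := hf.trans s.δ_cone
    replace hne : s ≠ t := hne
    replace hd : s.dim = t.dim := hd
    obtain ⟨n, m, x, k, hx, h₁, h₂⟩ := s
    dsimp only at f hmono hf hd ⊢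
    subst hd
    obtain ⟨j, rfl⟩ := SimplexCategory.eq_δ_of_mono f
    have hj : j ≠ t.top.succ := by
      rintro rfl
      refine hne (Index.ext_simplex ?_)
      rw [S.ext_iff]
      exact hf.symm.trans t.δ_cone
    let y := SimplicialObject.δ (T.filtration (t.level + 1) : SSet.{u}) j t.cone
    have hy : x.1 = y.1 := hf.symm
    -- A face may fall into an earlier stage, where nothing is known about its top; this is why the
    -- level comes first in the lexicographic order.
    obtain h | rfl := (level_unique hy hx.not_isFixed).lt_or_eq
    · exact Prod.Lex.toLex_lt_toLex.2 (Or.inl h)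
    · obtain rfl : x = y := Subtype.ext hy
      exact Prod.Lex.toLex_lt_toLex.2 (Or.inr ⟨rfl, t.isTop.lt_of_δ_cone hj hx h₁⟩)

instance : T.pairingCore.IsRegular := T.weakRankFunction.isRegular

end SubdivTower

/-! ### Regular pairings have finite heights -/

namespace Subcomplex.Pairing

variable {B : SSet.{u}} {A : B.Subcomplex} (P : A.Pairing)

lemma ancestralRel_of_mem_antII [P.IsProper] {x y : P.II} {c : B.S} (hc : c ∈ P.antII y)
    (hx : x.1.toS ≤ c) : P.AncestralRel x y := by
  obtain ⟨_, ⟨j, hj, rfl⟩, f, -, hf⟩ := hc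
  have hc' : c ≤ S.mk (B.δ j ((P.p y).1.cast (P.isUniquelyCodimOneFace y).dim_eq).simplex) :=
    S.le_iff.2 ⟨f, hf⟩
  have hxd := hx.trans hc'
  have hle : x.1 ≤ (P.p y).1 := by
    have h := hxd.trans (S.mk_map_le _ _)
    change x.1.toS ≤ ((P.p y).1.cast (P.isUniquelyCodimOneFace y).dim_eq).toS at h
    rwa [N.cast_eq_self] at h
  refine ⟨?_, lt_of_le_of_ne' hle (P.ne _ _)⟩
  -- If `x = y`, then `y` lies under a face of `P y` of its own dimension. Nondegeneracy forces the
  -- comparing operator to be the identity, so that face is `y`, against the uniqueness of the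
  -- index.
  rintro rfl
  apply hj
  rw [← (P.isUniquelyCodimOneFace x).δ_eq_iff rfl]
  obtain ⟨g, hg⟩ := S.le_iff.1 hxd
  change ⦋x.1.dim⦌ ⟶ ⦋x.1.dim⦌ at g
  have := B.mono_of_nonDegenerate ⟨_, x.1.nonDegenerate⟩ g _ hg
  obtain rfl := SimplexCategory.eq_id_of_mono g
  rw [op_id, B.map_id] at hg
  exact hg

/-- Induction on a bound for the rank: a type II cell attached to an antecedent of `b` is an
ancestor of the one attached to `b`, so its rank is strictly smaller. -/
lemma antIter_eq_empty [P.IsRegular] (k : ℕ) (b : B.S)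
    (hb : ∀ x : P.II, b.toN = x.1.toN ∨ b.toN = (P.p x).1.toN → P.rank x < k) :
    P.antIter (k + 1) b = ∅ := by
  induction k generalizing b with
  | zero =>
    ext c
    simp only [antIter, ant, Set.mem_iUnion, Set.mem_empty_iff_false, iff_false]
    rintro ⟨_, ⟨x, hx, _⟩, _⟩
    exact Nat.not_lt_zero _ (hb x hx)
  | succ k hk =>
    rw [antIter]
    simp only [Set.iUnion_eq_empty]
    rintro c ⟨x, hx, hc⟩
    refine hk c fun y hy ↦ ?_
    have hyc : y.1.toS ≤ c := by
      rw [S.toN_eq_iff, S.toN_eq_iff] at hy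
      obtain hy | hy := hy
      · exact hy.le
      · exact le_trans (P.le y) (S.le_def.2 hy.le)
    have := P.rank_lt (P.ancestralRel_of_mem_antII hc hyc)
    have := hb x hx
    lia

lemma hasFiniteHeight [P.IsRegular] (x : P.II) : P.HasFiniteHeight x.1.toS := by
  refine ⟨P.rank x + 2, P.antIter_eq_empty (P.rank x + 1) _ fun y hy ↦ ?_⟩
  rw [S.toN_eq_iff.2 rfl] at hy
  obtain hy | hy := hy
  · obtain rfl : x = y := Subtype.ext ((N.ext_iff _ _).2 hy)
    exact Nat.lt_succ_self _
  · exact (P.ne _ _ ((N.ext_iff _ _).2 hy.symm)).elim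

end Subcomplex.Pairing

variable {A B : SSet.{u}} {f : A ⟶ B}

lemma strongAnodyneExtensions.isStronglyAnodyne (hf : strongAnodyneExtensions f) :
    IsStronglyAnodyne f := by
  obtain ⟨_, P, _⟩ := hf
  exact ⟨modelCategoryQuillen.cofibration_of_mono f,
    ⟨{ pairing := P, isProper := inferInstance, hasFiniteHeight := P.hasFiniteHeight }⟩⟩

/-! ### The action on `Ex W` and its fixed simplices -/

variable {W W' : SSet.{u}} {n : ℕ}

/-- The map between subdivided simplices induced by a morphism `p`. -/
noncomputable def SubdivHom.sdMap {m n : ℕ} (p : SubdivHom.{u} m n) :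
    SimplexCategory.sd.{u}.obj ⦋m⦌ ⟶ SimplexCategory.sd.{u}.obj ⦋n⦌ :=
  PartOrd.nerveFunctor.map (PartOrd.ofHom p.hom)

/-- The action on `Ex W` given by precomposition. -/
noncomputable def exAction (W : SSet.{u}) : SubdivAction (ex.obj W) where
  act p x := ULift.up (p.sdMap ≫ x.down)
  act_comp q p x := congrArg ULift.up ((congrArg (· ≫ x.down)
    (PartOrd.nerveFunctor.map_comp (PartOrd.ofHom p.hom) (PartOrd.ofHom q.hom))).trans
      (Category.assoc _ _ _))
  act_ofHom _ _ := rfl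

lemma ex_map_act (g : W ⟶ W') {m n : ℕ} (p : SubdivHom.{u} m n) (x : (ex.obj W) _⦋n⦌) :
    (ex.map g).app _ ((exAction W).act p x) = (exAction W').act p ((ex.map g).app _ x) :=
  congrArg ULift.up (Category.assoc p.sdMap x.down g)

lemma SubdivHom.sdMap_comp_sdMax {m n : ℕ} (p : SubdivHom.{u} m n) (θ : ⦋m⦌ ⟶ ⦋n⦌)
    (hθ : ∀ s, (chainMax (p.hom s)).down = θ (chainMax s).down) :
    p.sdMap ≫ sdMax.app ⦋n⦌ = sdMax.app ⦋m⦌ ≫ SSet.stdSimplex.map θ := by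
  have h : PartOrd.ofHom p.hom ≫ maxTrans.app ⦋n⦌ =
      maxTrans.app ⦋m⦌ ≫ SimplexCategory.toPartOrd.map θ := by
    ext s
    exact ULift.ext _ _ (hθ s)
  have h₁ := ((PartOrd.nerveFunctor.map_comp _ _).symm.trans
    (congrArg PartOrd.nerveFunctor.map h)).trans (PartOrd.nerveFunctor.map_comp _ _)
  have h₂ := nerveIsoStdSimplex.{u}.hom.naturality θ
  exact (Category.assoc _ _ _).symm.trans
    ((congrArg (· ≫ nerveIsoStdSimplex.hom.app ⦋n⦌) h₁).trans ((Category.assoc _ _ _).trans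
      ((congrArg (PartOrd.nerveFunctor.map (maxTrans.app ⦋m⦌) ≫ ·) h₂).trans
        (Category.assoc _ _ _).symm)))

lemma act_toEx {m n : ℕ} (p : SubdivHom.{u} m n) (θ : ⦋m⦌ ⟶ ⦋n⦌)
    (hθ : ∀ s, (chainMax (p.hom s)).down = θ (chainMax s).down) (w : W _⦋n⦌) :
    (exAction W).act p ((toEx.app W).app _ w) = (toEx.app W).app _ (W.map θ.op w) := by
  refine congrArg ULift.up ?_
  have h : yonedaEquiv.symm (W.map θ.op w) = SSet.stdSimplex.map θ ≫ yonedaEquiv.symm w := by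
    rw [Equiv.symm_apply_eq, ← yonedaEquiv_naturality, Equiv.apply_symm_apply]
  change p.sdMap ≫ sdMax.app ⦋n⦌ ≫ yonedaEquiv.symm w =
    sdMax.app ⦋m⦌ ≫ yonedaEquiv.symm (W.map θ.op w)
  rw [h, ← Category.assoc, p.sdMap_comp_sdMax θ hθ, Category.assoc]

/-- The section of the maximum map which sends `i` to `{0, ..., i}`. -/
noncomputable def initialSegment (n : ℕ) : ULift.{u} (Fin (n + 1)) →o Chains.{u} n where
  toFun a := ofPred n (fun i ↦ i ≤ a.down) ⟨a.down, Nat.lt_succ_iff.1 a.down.2, le_rfl⟩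
  monotone' a b h := by
    rw [le_iff_mem]
    intro i
    simp only [mem_ofPred]
    exact fun hi ↦ ⟨hi.1, hi.2.trans h⟩

lemma mem_initialSegment (a : ULift.{u} (Fin (n + 1))) (i : ℕ) :
    Mem i (initialSegment n a) ↔ i ≤ a.down :=
  (mem_ofPred _ _).trans (and_iff_right_of_imp fun h ↦ h.trans (Nat.lt_succ_iff.1 a.down.2))

/-- The section of `sdMax` induced by `initialSegment`. -/
noncomputable def sdMaxSection (n : ℕ) : Δ[n] ⟶ SimplexCategory.sd.{u}.obj ⦋n⦌ :=
  nerveIsoStdSimplex.inv.app ⦋n⦌ ≫ PartOrd.nerveFunctor.map (PartOrd.ofHom (initialSegment n))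

lemma sdMaxSection_sdMax (n : ℕ) : sdMaxSection.{u} n ≫ sdMax.app ⦋n⦌ = 𝟙 _ := by
  have h : PartOrd.ofHom (initialSegment n) ≫ maxTrans.app ⦋n⦌ = 𝟙 _ := by
    ext a
    refine ULift.ext _ _ (Fin.ext (top_eq ((mem_initialSegment _ _).2 le_rfl) fun j hj ↦
      (mem_initialSegment _ _).1 hj))
  have h₁ := ((PartOrd.nerveFunctor.map_comp _ _).symm.trans
    (congrArg PartOrd.nerveFunctor.map h)).trans (PartOrd.nerveFunctor.map_id _)
  have h₂ := nerveIsoStdSimplex.{u}.inv_hom_id_app ⦋n⦌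
  calc
    _ = nerveIsoStdSimplex.{u}.inv.app ⦋n⦌ ≫
        (PartOrd.nerveFunctor.map (PartOrd.ofHom (initialSegment n)) ≫
          PartOrd.nerveFunctor.map (maxTrans.app ⦋n⦌)) ≫ nerveIsoStdSimplex.hom.app ⦋n⦌ := rfl
    _ = nerveIsoStdSimplex.{u}.inv.app ⦋n⦌ ≫ 𝟙 _ ≫ nerveIsoStdSimplex.hom.app ⦋n⦌ :=
      congrArg (fun f ↦ nerveIsoStdSimplex.{u}.inv.app ⦋n⦌ ≫ f ≫ nerveIsoStdSimplex.hom.app ⦋n⦌) h₁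
    _ = 𝟙 _ := h₂

/-- The composition of the operators `fill n k` for `k ≤ j`. -/
noncomputable def SubdivHom.fillUpTo (n j : ℕ) : SubdivHom.{u} n n :=
  match j with
  | 0 => SubdivHom.id n
  | j + 1 => (fill n (j + 1)).comp (fillUpTo n j)

lemma SubdivHom.mem_fillUpTo (j : ℕ) (s : Chains.{u} n) (i : ℕ) :
    Mem i ((fillUpTo n j).hom s) ↔ Mem i s ∨ ∃ l ≤ j, i ≤ l ∧ Mem l s := by
  induction j generalizing i with
  | zero =>
    simp only [fillUpTo, id_hom]
    grind
  | succ j hj =>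
    simp only [fillUpTo, comp_hom, mem_fill, hj]
    grind

/-- Filling at every element of `s` yields `{0, ..., max s}`. Starting the composite from the
identity loses nothing, as the fill at `0` adds no element. -/
lemma SubdivHom.sdMap_fillUpTo :
    (fillUpTo.{u} n n).sdMap = sdMax.app ⦋n⦌ ≫ sdMaxSection n := by
  have h : PartOrd.ofHom (fillUpTo.{u} n n).hom =
      maxTrans.app ⦋n⦌ ≫ PartOrd.ofHom (initialSegment n) := by
    refine ConcreteCategory.hom_ext _ _ fun s ↦ Chains.ext_mem fun i ↦ (mem_fillUpTo _ _ _).trans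
      (Iff.trans ?_ (mem_initialSegment _ _).symm)
    constructor
    · rintro (h | ⟨l, _, h, h'⟩)
      · exact le_top h
      · exact h.trans (le_top h')
    · exact fun h ↦ Or.inr ⟨_, (mem_top s).le, h, mem_top s⟩
  have h₂ := nerveIsoStdSimplex.{u}.hom_inv_id_app ⦋n⦌
  have h₃ := congrArg (fun f ↦ PartOrd.nerveFunctor.map (maxTrans.app ⦋n⦌) ≫ f ≫
    PartOrd.nerveFunctor.map (PartOrd.ofHom (initialSegment n))) h₂
  exact ((congrArg PartOrd.nerveFunctor.map h).trans (PartOrd.nerveFunctor.map_comp _ _)).trans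
    h₃.symm

lemma SubdivAction.IsFixed.act_fillUpTo {V : SSet.{u}} {a : SubdivAction V} {x : V _⦋n⦌}
    (hx : a.IsFixed x) (j : ℕ) : a.act (fillUpTo n j) x = x := by
  induction j with
  | zero => exact a.act_id x
  | succ j hj => rw [fillUpTo, a.act_comp, hx, hj]

lemma exAction_isFixed_iff (x : (ex.obj W) _⦋n⦌) :
    (exAction W).IsFixed x ↔ ∃ w : W _⦋n⦌, (toEx.app W).app _ w = x := by
  constructor
  · intro hx
    have h := congrArg ULift.down (hx.act_fillUpTo n)
    change (fillUpTo n n).sdMap ≫ x.down = x.down at h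
    refine ⟨yonedaEquiv (sdMaxSection n ≫ x.down), congrArg ULift.up ?_⟩
    change sdMax.app ⦋n⦌ ≫ _ = x.down
    rw [Equiv.symm_apply_apply, ← Category.assoc, ← sdMap_fillUpTo, h]
  · rintro ⟨w, rfl⟩ k
    rw [act_toEx _ (𝟙 _) (top_fill k), op_id, W.map_id]
    rfl

/-- Precomposition with `sdMax` is injective because `sdMax` has the section `sdMaxSection`. -/
instance : Mono (toEx.app W) := by
  have (n : SimplexCategoryᵒᵖ) : Mono ((toEx.app W).app n) := by
    induction n using Opposite.rec with | _ n
    induction n using SimplexCategory.rec with | _ n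
    rw [mono_iff_injective]
    intro w w' h
    replace h : sdMax.app ⦋n⦌ ≫ yonedaEquiv.symm w = sdMax.app ⦋n⦌ ≫ yonedaEquiv.symm w' :=
      congrArg ULift.down h
    replace h := congrArg (sdMaxSection n ≫ ·) h
    simp only [← Category.assoc, sdMaxSection_sdMax] at h
    exact yonedaEquiv.symm.injective (by simpa using h)
  exact NatTrans.mono_of_mono_app _

lemma app_injective {X Y : SSet.{u}} (g : X ⟶ Y) [Mono g] (n : SimplexCategoryᵒᵖ) :
    Function.Injective (g.app n) :=
  (mono_iff_injective _).1 inferInstance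

/-- The restriction of an action along a monomorphism whose image is stable. -/
noncomputable def SubdivAction.restrict {V V' : SSet.{u}} (a : SubdivAction V') (g : V ⟶ V')
    [Mono g] (h : ∀ {m n : ℕ} (p : SubdivHom.{u} m n) (x : V _⦋n⦌),
      ∃ y, g.app (op ⦋m⦌) y = a.act p (g.app _ x)) : SubdivAction V where
  act p x := (h p x).choose
  act_comp q p x := app_injective g _ (by
    rw [(h _ _).choose_spec, (h _ _).choose_spec, (h _ _).choose_spec, a.act_comp])
  act_ofHom θ x := app_injective g _ (by
    rw [(h _ _).choose_spec, a.act_ofHom, NatTrans.naturality_apply])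

lemma SubdivAction.restrict_isFixed_iff {V V' : SSet.{u}} (a : SubdivAction V') (g : V ⟶ V')
    [Mono g] (h : ∀ {m n : ℕ} (p : SubdivHom.{u} m n) (x : V _⦋n⦌),
      ∃ y, g.app (op ⦋m⦌) y = a.act p (g.app _ x)) {n : ℕ} (x : V _⦋n⦌) :
    (a.restrict g h).IsFixed x ↔ a.IsFixed (g.app _ x) :=
  forall_congr' fun _ ↦ by
    rw [← (app_injective g _).eq_iff]
    exact Eq.congr_left (h _ _).choose_spec

/-! ### The finite stages inside `Ex^∞ X` -/

/-- The map `Ex^m X ⟶ Ex^∞ X`. -/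
noncomputable def exIterToExInfty (X : SSet.{u}) (m : ℕ) : (exIter m).obj X ⟶ exInfty.obj X :=
  colimit.ι (exSequence.obj X) m

lemma exSequence_map_succ (X : SSet.{u}) (m : ℕ) :
    (exSequence.obj X).map (homOfLE (Nat.le_add_right m 1)) =
      toEx.app ((exIter m).obj X) :=
  congrArg (fun t ↦ NatTrans.app t X) (Functor.ofSequence_map_homOfLE_succ exIterSucc.{u} m)

lemma toEx_exIterToExInfty (X : SSet.{u}) (m : ℕ) :
    toEx.app ((exIter m).obj X) ≫ exIterToExInfty X (m + 1) = exIterToExInfty X m := by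
  have h := colimit.w (exSequence.obj X) (homOfLE (Nat.le_add_right m 1))
  rw [exSequence_map_succ] at h
  exact h

lemma exIterToExInfty_naturality {X Y : SSet.{u}} (f : X ⟶ Y) (m : ℕ) :
    exIterToExInfty X m ≫ exInfty.map f = (exIter m).map f ≫ exIterToExInfty Y m :=
  ι_colimMap (exSequence.map f) m

instance mono_exSequence_map (X : SSet.{u}) {i j : ℕ} (φ : i ⟶ j) :
    Mono ((exSequence.obj X).map φ) := by
  obtain ⟨k, rfl⟩ := Nat.exists_eq_add_of_le (leOfHom φ)
  obtain rfl := Subsingleton.elim φ (homOfLE (Nat.le_add_right i k))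
  induction k with
  | zero =>
    have : homOfLE (Nat.le_add_right i 0) = 𝟙 i := rfl
    rw [this, CategoryTheory.Functor.map_id]
    infer_instance
  | succ k hk =>
    have h : homOfLE (Nat.le_add_right i (k + 1)) =
      homOfLE (Nat.le_add_right i k) ≫ homOfLE (Nat.le_add_right (i + k) 1) := rfl
    rw [h, Functor.map_comp, exSequence_map_succ]
    exact mono_comp' hk (inferInstanceAs (Mono (toEx.app ((exIter (i + k)).obj X))))

instance (X : SSet.{u}) (m : ℕ) : Mono (exIterToExInfty X m) := by
  have (n : SimplexCategoryᵒᵖ) : Mono ((exIterToExInfty X m).app n) := by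
    rw [mono_iff_injective]
    intro x y h
    obtain ⟨j, φ, h⟩ := (Types.FilteredColimit.isColimit_eq_iff'
      (isColimitOfPreserves ((evaluation _ _).obj n) (colimit.isColimit (exSequence.obj X)))
      x y).1 h
    exact app_injective ((exSequence.obj X).map φ) n h
  exact NatTrans.mono_of_mono_app _

lemma exists_exIterToExInfty (X : SSet.{u}) {n : SimplexCategoryᵒᵖ}
    (x : (exInfty.obj X).obj n) : ∃ m y, (exIterToExInfty X m).app n y = x :=
  Types.jointly_surjective_of_isColimit
    (isColimitOfPreserves ((evaluation _ _).obj n) (colimit.isColimit (exSequence.obj X))) x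

/-- The map `X ⟶ Ex^m X`. -/
noncomputable def toExIter (X : SSet.{u}) (m : ℕ) : X ⟶ (exIter m).obj X :=
  match m with
  | 0 => 𝟙 X
  | m + 1 => toExIter X m ≫ toEx.app ((exIter m).obj X)

lemma toExIter_exIterToExInfty (X : SSet.{u}) (m : ℕ) :
    toExIter X m ≫ exIterToExInfty X m = toExInfty.app X := by
  induction m with
  | zero => exact Category.id_comp _
  | succ m hm =>
    exact (Category.assoc _ _ _).trans
        ((congrArg (toExIter X m ≫ ·) (toEx_exIterToExInfty X m)).trans hm)

instance (X : SSet.{u}) : Mono (toExInfty.app X) :=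
  inferInstanceAs (Mono (exIterToExInfty X 0))

lemma exists_pullback_fst_eq {X Y Z : SSet.{u}} (f : X ⟶ Z) (g : Y ⟶ Z) {n : ℕ}
    (x : X _⦋n⦌) (y : Y _⦋n⦌) (h : f.app _ x = g.app _ y) :
    ∃ z : (pullback f g) _⦋n⦌, (pullback.fst f g).app _ z = x := by
  refine ⟨yonedaEquiv (pullback.lift (yonedaEquiv.symm x) (yonedaEquiv.symm y) ?_), ?_⟩
  · rw [yonedaEquiv_symm_comp, yonedaEquiv_symm_comp, h]
  · rw [← yonedaEquiv_comp, pullback.lift_fst, Equiv.apply_symm_apply]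

/-! ### The tower on the fibre product -/

section

variable {X Y : SSet.{u}} (f : X ⟶ Y)

/-- The projection `Ex^∞ X ×_{Ex^∞ Y} Y ⟶ Ex^∞ X`. -/
noncomputable abbrev exInftyPullbackFst :
    pullback (Y := Y) (exInfty.map f) (toExInfty.app Y) ⟶ exInfty.obj X :=
  pullback.fst (Y := Y) (exInfty.map f) (toExInfty.app Y)

/-- The simplices of `Ex^∞ X ×_{Ex^∞ Y} Y` whose first component comes from `Ex^m X`. -/
noncomputable def exInftyFiltration (m : ℕ) :
    (pullback (Y := Y) (exInfty.map f) (toExInfty.app Y)).Subcomplex :=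
  (Subcomplex.range (exIterToExInfty X m)).preimage (exInftyPullbackFst f)

lemma mem_exInftyFiltration_iff (m : ℕ) {n : SimplexCategoryᵒᵖ}
    (z : (pullback (Y := Y) (exInfty.map f) (toExInfty.app Y)).obj n) :
    z ∈ (exInftyFiltration f m).obj n ↔
      ∃ a, (exIterToExInfty X m).app n a = (exInftyPullbackFst f).app n z :=
  Iff.rfl

/-- The map to `Ex^m X` from the `m`-th step of the filtration. -/
noncomputable def exInftyFiltrationToExIter (m : ℕ) :
    (exInftyFiltration f m : SSet.{u}) ⟶ (exIter m).obj X :=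
  Subcomplex.lift ((exInftyFiltration f m).ι ≫ exInftyPullbackFst f) (by
      rintro n _ ⟨z, rfl⟩
      exact z.2) ≫
      inv (Subcomplex.toRange (exIterToExInfty X m))

lemma exInftyFiltrationToExIter_comp (m : ℕ) :
    exInftyFiltrationToExIter f m ≫ exIterToExInfty X m =
      (exInftyFiltration f m).ι ≫ exInftyPullbackFst f := by
  have h : inv (Subcomplex.toRange (exIterToExInfty X m)) ≫ exIterToExInfty X m =
      (Subcomplex.range (exIterToExInfty X m)).ι := by
    rw [IsIso.inv_comp_eq, Subcomplex.toRange_ι]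
  exact (Category.assoc _ _ _).trans (congrArg (Subcomplex.lift _ _ ≫ ·) h)

instance instMonoExInftyFiltrationToExIter (m : ℕ) :
    Mono (exInftyFiltrationToExIter f m) := by
  have := exInftyFiltrationToExIter_comp f m
  exact mono_of_mono_fac this

lemma exInftyFiltrationToExIter_apply (m : ℕ) {n : SimplexCategoryᵒᵖ}
    (z : (exInftyFiltration f m : SSet.{u}).obj n) :
    (exIterToExInfty X m).app n ((exInftyFiltrationToExIter f m).app n z) =
      (exInftyPullbackFst f).app n z.1 :=
  ConcreteCategory.congr_hom (NatTrans.congr_app (exInftyFiltrationToExIter_comp f m) n) z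

/-- For a simplex with components `(a, y)`, the new one has components `(a · p, θ^* y)`, where `θ`
is the base of `p`. They still match over `Y`, because the image of `a` comes from `y` through
`toEx`, where `p` acts as `θ`. -/
lemma exists_exInftyFiltrationToExIter_eq_act (k : ℕ) {m n : ℕ} (p : SubdivHom.{u} m n)
    (z : (exInftyFiltration f (k + 1) : SSet.{u}) _⦋n⦌) :
    ∃ z', (exInftyFiltrationToExIter f (k + 1)).app (op ⦋m⦌) z' =
      (exAction ((exIter k).obj X)).act p ((exInftyFiltrationToExIter f (k + 1)).app _ z) := by
  set a := (exInftyFiltrationToExIter f (k + 1)).app _ z with ha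
  obtain ⟨θ, hθ⟩ := p.exists_base
  have nat {l : ℕ} (b : ((exIter (k + 1)).obj X) _⦋l⦌) :
      (exInfty.map f).app _ ((exIterToExInfty X (k + 1)).app _ b) =
        (exIterToExInfty Y (k + 1)).app _ (((exIter (k + 1)).map f).app _ b) :=
    ConcreteCategory.congr_hom (NatTrans.congr_app (exIterToExInfty_naturality f (k + 1)) _) b
  have incl {l : ℕ} (y : Y _⦋l⦌) : (toExInfty.app Y).app _ y =
      (exIterToExInfty Y (k + 1)).app _ ((toEx.app _).app _ ((toExIter Y k).app _ y)) :=
    (ConcreteCategory.congr_hom (NatTrans.congr_app (toExIter_exIterToExInfty Y (k + 1)) _) y).symm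
  let y : Y _⦋n⦌ := (pullback.snd (Y := Y) (exInfty.map f) (toExInfty.app Y)).app _ z.1
  have hy : (exInfty.map f).app _ ((exInftyPullbackFst f).app _ z.1) = (toExInfty.app Y).app _ y :=
    ConcreteCategory.congr_hom (NatTrans.congr_app
      (pullback.condition (Y := Y) (f := exInfty.map f) (g := toExInfty.app Y)) (op ⦋n⦌)) z.1
  have hfa : ((exIter (k + 1)).map f).app _ a = (toEx.app _).app _ ((toExIter Y k).app _ y) := by
    apply app_injective (exIterToExInfty Y (k + 1))
    rw [← incl, ← hy, ← exInftyFiltrationToExIter_apply]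
    exact (nat a).symm
  have hfb : ((exIter (k + 1)).map f).app _ ((exAction ((exIter k).obj X)).act p a) =
      (toEx.app _).app _ ((toExIter Y k).app _ (Y.map θ.op y)) := by
    refine (ex_map_act ((exIter k).map f) p a).trans ?_
    refine (congrArg ((exAction ((exIter k).obj Y)).act p) hfa).trans ?_
    rw [act_toEx p θ hθ]
    exact congrArg _ (NatTrans.naturality_apply (toExIter Y k) θ.op y).symm
  obtain ⟨w, hw⟩ := exists_pullback_fst_eq (Y := Y) (exInfty.map f) (toExInfty.app Y)
    ((exIterToExInfty X (k + 1)).app _ ((exAction ((exIter k).obj X)).act p a)) (Y.map θ.op y)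
    ((nat _).trans ((congrArg _ hfb).trans (incl _).symm))
  refine ⟨⟨w, _, hw.symm⟩, ?_⟩
  apply app_injective (exIterToExInfty X (k + 1))
  exact (exInftyFiltrationToExIter_apply f (k + 1) _).trans hw

/-- The tower of the subcomplexes of `Ex^∞ X ×_{Ex^∞ Y} Y` coming from the simplicial
sets `Ex^m X`. -/
noncomputable def exInftyTower : SubdivTower (Subcomplex.range (toExInftyPullback f)) where
  filtration := exInftyFiltration f
  filtration_zero := by
    ext n z
    rw [mem_exInftyFiltration_iff]
    have hx (x : X.obj n) : (exInftyPullbackFst f).app n ((toExInftyPullback f).app n x) =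
        (exIterToExInfty X 0).app n x :=
      ConcreteCategory.congr_hom (NatTrans.congr_app (pullback.lift_fst (Y := Y) (toExInfty.app X) f
        (toExInfty.naturality f).symm) n) x
    constructor
    · rintro ⟨a, ha⟩
      exact ⟨a, app_injective (exInftyPullbackFst f) n ((hx a).trans ha)⟩
    · rintro ⟨x, rfl⟩
      exact ⟨x, (hx x).symm⟩
  monotone := monotone_nat_of_le_succ fun m n z ⟨a, ha⟩ ↦
    ⟨(toEx.app _).app n a, (ConcreteCategory.congr_hom
      (NatTrans.congr_app (toEx_exIterToExInfty X m) n) a).trans ha⟩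
  exists_mem z := exists_exIterToExInfty X _
  action m := @SubdivAction.restrict _ _ (exAction ((exIter m).obj X))
    (exInftyFiltrationToExIter f (m + 1)) (instMonoExInftyFiltrationToExIter f (m + 1))
    (exists_exInftyFiltrationToExIter_eq_act f m)
  isFixed_iff {m n} z := by
    refine (@SubdivAction.restrict_isFixed_iff _ _ _ _
      (instMonoExInftyFiltrationToExIter f (m + 1)) _ _ _).trans
        ((exAction_isFixed_iff _).trans (exists_congr fun a ↦ ?_))
    rw [← exInftyFiltrationToExIter_apply]
    refine (app_injective (exIterToExInfty X (m + 1)) _).eq_iff.symm.trans ?_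
    exact Eq.congr_left (ConcreteCategory.congr_hom
      (NatTrans.congr_app (toEx_exIterToExInfty X m) (op ⦋n⦌)) a)

instance : Mono (toExInftyPullback f) := by
  have : toExInftyPullback f ≫ exInftyPullbackFst f = toExInfty.app X :=
    pullback.lift_fst (Y := Y) _ _ _
  exact mono_of_mono_fac this

lemma strongAnodyneExtensions_toExInftyPullback :
    strongAnodyneExtensions (toExInftyPullback f) :=
  ⟨inferInstance, (exInftyTower f).pairingCore.pairing, inferInstance⟩

end

/-! ### The case of a point, and anodyneness of `X ⟶ Ex^∞ X` -/

instance : PreservesLimits ex.{u} := sdExAdjunction.rightAdjoint_preservesLimits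

/-- The functor `Ex^m` preserves terminal objects. -/
noncomputable def isTerminalExIterObj {T : SSet.{u}} (hT : IsTerminal T) (m : ℕ) :
    IsTerminal ((exIter m).obj T) :=
  match m with
  | 0 => hT
  | m + 1 => IsTerminal.isTerminalObj ex _ (isTerminalExIterObj hT m)

/-- `Ex` is a right adjoint, so every stage is terminal and the sequence consists of isomorphisms.
-/
lemma isIso_toExInfty_app {T : SSet.{u}} (hT : IsTerminal T) : IsIso (toExInfty.app T) := by
  have (i j : ℕ) (φ : i ⟶ j) : IsIso ((exSequence.obj T).map φ) :=
    isIso_of_isTerminal (isTerminalExIterObj hT i) (isTerminalExIterObj hT j) _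
  exact isIso_ι_of_isInitial (j := 0) (isInitialBot (α := ℕ)) (exSequence.obj T)

lemma anodyneExtensions_toExInfty (X : SSet.{u}) : anodyneExtensions (toExInfty.app X) := by
  have := isIso_toExInfty_app (terminalIsTerminal (C := SSet.{u}))
  let f := terminal.from X
  have hf := strongAnodyneExtensions_le_anodyneExtensions _
    (strongAnodyneExtensions_toExInftyPullback f)
  have h : toExInftyPullback f ≫ exInftyPullbackFst f = toExInfty.app X :=
    pullback.lift_fst (Y := ⊤_ SSet.{u}) _ _ _
  -- Over a point, the fibre product is `Ex^∞ X` itself, the projection being a base change of an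
  -- isomorphism.
  have : IsIso (exInftyPullbackFst f) :=
    @pullback_fst_iso_of_right_iso _ _ _ (⊤_ SSet.{u}) _ (exInfty.map f) (toExInfty.app _) this
  rw [← h]
  exact anodyneExtensions.comp_mem _ _ hf (.of_isIso (exInftyPullbackFst f))

end SSet

theorem mainTheorem7 (X : SSet.{u}) [IsCofibrant X] :
    (∀ (Y : SSet.{u}) (f : X ⟶ Y), SSet.IsStronglyAnodyne (SSet.toExInftyPullback f)) ∧
      SSet.anodyneExtensions (SSet.toExInfty.app X) := by
  exact ⟨fun _ f ↦ (SSet.strongAnodyneExtensions_toExInftyPullback f).isStronglyAnodyne,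
    SSet.anodyneExtensions_toExInfty X⟩
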